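/- Let $n\ge 1$, let $\Omega\subset\mathbb{R}^n$ be a bounded domain (non-empty, open, connected), and let $1<p<r<p^*$, where $p^*=\frac{np}{n-p}$ if $p<n$ and $p^*=+\infty$ otherwise. Let \[ \lambda_1(p)=\inf_{u\in W^{1,p}_0(\Omega)\setminus\{0\}}\frac{\int_\Omega|\nabla u|^p}{\int_\Omega|u|^p} \] be the first Dirichlet eigenvalue of the $p$-Laplacian, and for $1<q<p$ set \[ \hat\Lambda(p,q,r)=\lambda_1(p)^{\frac{r-q}{r-p}}\,(r-p)\left(\frac{(p-q)^{p-q}}{(r-q)^{r-q}}\right)^{\frac1{r-p}}. \] For $1<q<p$ and $\Lambda\in\mathbb{R}$ consider the problem \[ -\Delta_p u=\Lambda\,u^{q-1}+u^{r-1}\ \text{ in }\Omega,\qquad u=0\ \text{ on }\partial\Omega. \] A positive weak solution is a function $u\in W^{1,p}_0(\Omega)$ with $u>0$ a.e. in $\Omega$, with $\Lambda u^{q-1}+u^{r-1}\in L^1_{\mathrm{loc}}(\Omega)$, and with \[ \int_\Omega|\nabla u|^{p-2}\nabla u\cdot\nabla\varphi=\int_\Omega(\Lambda u^{q-1}+u^{r-1})\varphi\qquad\text{for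 all }\varphi\in C_c^\infty(\Omega). \] Let $\Lambda_{q,r}\in[0,\infty]$ be the supremum of all $\Lambda>0$ for which the problem has a positive weak solution (with $\sup\emptyset=0$). Then, for every $q\in(1,p)$, the problem has no positive weak solution for $\Lambda>\hat\Lambda(p,q,r)$, and consequently $\Lambda_{q,r}\le\hat\Lambda(p,q,r)$. Moreover, for fixed $p$ and $r$, \[ \limsup_{q\to p^-}\Lambda_{q,r}\le\lambda_1(p). \] -/

import Mathlib

open MeasureTheory Filter Topology
open scoped ENNReal ContDiff

noncomputable section

namespace ConcaveConvex

/-- Test functions: smooth functions on `ℝⁿ` with compact support contained in `Ω`. -/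
structure IsTestFunction {n : ℕ} (Ω : Set (EuclideanSpace ℝ (Fin n)))
    (φ : EuclideanSpace ℝ (Fin n) → ℝ) : Prop where
  contDiff : ContDiff ℝ ∞ φ
  hasCompactSupport : HasCompactSupport φ
  tsupport_subset : tsupport φ ⊆ Ω

/-- `G` is the weak (distributional) gradient of `u` in `Ω`. -/
structure HasWeakGradient {n : ℕ} (Ω : Set (EuclideanSpace ℝ (Fin n)))
    (u : EuclideanSpace ℝ (Fin n) → ℝ)
    (G : EuclideanSpace ℝ (Fin n) → EuclideanSpace ℝ (Fin n)) : Prop where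
  locallyIntegrableOn : LocallyIntegrableOn u Ω
  locallyIntegrableOn_grad : LocallyIntegrableOn G Ω
  integral_eq : ∀ φ, IsTestFunction Ω φ →
    ∫ x in Ω, u x • gradient φ x = - ∫ x in Ω, φ x • G x

/-- `u ∈ W₀^{1,p}(Ω)` with weak gradient `G`: both are in `L^p(Ω)`, and `u` is a limit of test
functions in the norm of `W^{1,p}(Ω)`. Only the restrictions of `u` and `G` to `Ω` matter, up to
null sets. -/
structure MemSobolevZero {n : ℕ} (Ω : Set (EuclideanSpace ℝ (Fin n))) (p : ℝ)
    (u : EuclideanSpace ℝ (Fin n) → ℝ)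
    (G : EuclideanSpace ℝ (Fin n) → EuclideanSpace ℝ (Fin n)) : Prop where
  hasWeakGradient : HasWeakGradient Ω u G
  memLp : MemLp u (ENNReal.ofReal p) (volume.restrict Ω)
  memLp_grad : MemLp G (ENNReal.ofReal p) (volume.restrict Ω)
  exists_approx : ∃ φ : ℕ → EuclideanSpace ℝ (Fin n) → ℝ,
    (∀ k, IsTestFunction Ω (φ k)) ∧
    Tendsto (fun k => eLpNorm (fun x => φ k x - u x) (ENNReal.ofReal p) (volume.restrict Ω))
      atTop (𝓝 0) ∧
    Tendsto (fun k => eLpNorm (fun x => gradient (φ k) x - G x) (ENNReal.ofReal p)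
      (volume.restrict Ω)) atTop (𝓝 0)

/-- The first Dirichlet eigenvalue `λ₁(p)` of the `p`-Laplacian in `Ω`: the infimum of the Rayleigh
quotient over `W₀^{1,p}(Ω) \ {0}`. -/
def firstEigenvalue {n : ℕ} (Ω : Set (EuclideanSpace ℝ (Fin n))) (p : ℝ) : ℝ :=
  sInf {ρ : ℝ | ∃ u G, MemSobolevZero Ω p u G ∧ ¬ (u =ᵐ[volume.restrict Ω] 0) ∧
    ρ = (∫ x in Ω, ‖G x‖ ^ p) / ∫ x in Ω, |u x| ^ p}

/-- `u` is a positive weak solution of `-Δ_p u = Λ u^{q-1} + u^{r-1}` in `Ω`, `u = 0` on `∂Ω`. The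
boundary condition is `u ∈ W₀^{1,p}(Ω)`; the right-hand side is required to be locally
integrable, so that it can be tested. -/
def IsPositiveWeakSolution {n : ℕ} (Ω : Set (EuclideanSpace ℝ (Fin n))) (p q r Λ : ℝ)
    (u : EuclideanSpace ℝ (Fin n) → ℝ) : Prop :=
  (∀ᵐ x ∂(volume.restrict Ω), 0 < u x) ∧
  LocallyIntegrableOn (fun x => Λ * u x ^ (q - 1) + u x ^ (r - 1)) Ω ∧
  ∃ G, MemSobolevZero Ω p u G ∧ ∀ φ, IsTestFunction Ω φ →
    ∫ x in Ω, ‖G x‖ ^ (p - 2) * inner ℝ (G x) (gradient φ x) =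
      ∫ x in Ω, (Λ * u x ^ (q - 1) + u x ^ (r - 1)) * φ x

/-- The existence threshold `Λ_{q,r}`: the supremum, in `[0, ∞]`, of the `Λ > 0` for which there is
a positive weak solution. -/
def existenceThreshold {n : ℕ} (Ω : Set (EuclideanSpace ℝ (Fin n))) (p q r : ℝ) : ℝ≥0∞ :=
  sSup {L : ℝ≥0∞ | ∃ Λ : ℝ, 0 < Λ ∧ (∃ u, IsPositiveWeakSolution Ω p q r Λ u) ∧
    L = ENNReal.ofReal Λ}

/-- The explicit bound `Λ̂(p,q,r)`. -/
def upperThreshold {n : ℕ} (Ω : Set (EuclideanSpace ℝ (Fin n))) (p q r : ℝ) : ℝ :=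
  firstEigenvalue Ω p ^ ((r - q) / (r - p)) * (r - p) *
    ((p - q) ^ (p - q) / (r - q) ^ (r - q)) ^ (1 / (r - p))

end ConcaveConvex

end

/-! Suppose `u` is a positive solution with `Λ` above the threshold. Weighted AM-GM turns the
right-hand side into `Λ u^(q-1) + u^(r-1) ≥ μ u^(p-1)` for some `μ > λ₁(p)` (`exists_mul_rpow_le`).
So `u` is a positive supersolution of `-Δ_p u = μ u^(p-1)`, and Picone's inequality, i.e. testing
with `|φ|^p / u^(p-1)`, gives `μ ∫|φ|^p ≤ ∫|∇φ|^p` for every test function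
(`mul_integral_rpow_le_of_weak`). By density `μ ≤ λ₁(p)`, a contradiction.

The work lies in making that test function admissible, since `u` is only a Sobolev function and may
approach zero. It is replaced by `regPow p δ (u) * regAbs p η (φ)`, and
`integral_comp_mul_eq_of_weak` extends the equation to such products. A pointwise Picone inequality
survives the regularization up to an error of order `η^p`; one lets `η → 0` and then `δ → 0`.

The limsup bound follows because the explicit threshold tends to `λ₁(p)` as `q → p⁻`. -/

noncomputable section

namespace ConcaveConvex

/-! ### Calculus of gradients and test functions -/

section Gradient

variable {F : Type*} [NormedAddCommGroup F] [InnerProductSpace ℝ F] [CompleteSpace F]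

theorem gradient_fun_mul {f g : F → ℝ} {x : F} (hf : DifferentiableAt ℝ f x)
    (hg : DifferentiableAt ℝ g x) :
    gradient (fun y => f y * g y) x = f x • gradient g x + g x • gradient f x := by
  simp only [gradient]
  rw [fderiv_fun_mul hf hg, map_add, map_smulₛₗ, map_smulₛₗ]
  simp

theorem gradient_fun_comp {h : ℝ → ℝ} {f : F → ℝ} {x : F} (hh : DifferentiableAt ℝ h (f x))
    (hf : DifferentiableAt ℝ f x) :
    gradient (fun y => h (f y)) x = deriv h (f x) • gradient f x := by
  simp only [gradient]
  have h' : HasFDerivAt (fun y => h (f y)) (deriv h (f x) • fderiv ℝ f x) x :=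
    hh.hasDerivAt.comp_hasFDerivAt x hf.hasFDerivAt
  rw [h'.fderiv, map_smulₛₗ]
  simp

theorem continuous_gradient {f : F → ℝ} (hf : ContDiff ℝ ∞ f) : Continuous (gradient f) := by
  unfold gradient
  exact (InnerProductSpace.toDual ℝ F).symm.continuous.comp (hf.continuous_fderiv (by simp))

theorem support_gradient_subset (f : F → ℝ) : Function.support (gradient f) ⊆ tsupport f := by
  intro x hx
  refine support_fderiv_subset ℝ (f := f) ?_
  intro h0
  exact hx (by simp [gradient, h0])

end Gradient

section TestFunction

variable {n : ℕ} {Ω : Set (EuclideanSpace ℝ (Fin n))} {φ : EuclideanSpace ℝ (Fin n) → ℝ}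

theorem IsTestFunction.mul_left {g : EuclideanSpace ℝ (Fin n) → ℝ} (hg : ContDiff ℝ ∞ g)
    (hφ : IsTestFunction Ω φ) : IsTestFunction Ω (fun x => g x * φ x) where
  contDiff := hg.mul hφ.contDiff
  hasCompactSupport := hφ.hasCompactSupport.mul_left
  tsupport_subset := (tsupport_mul_subset_right).trans hφ.tsupport_subset

theorem IsTestFunction.comp_left {F : ℝ → ℝ} (hF : ContDiff ℝ ∞ F) (h0 : F 0 = 0)
    (hφ : IsTestFunction Ω φ) : IsTestFunction Ω (fun x => F (φ x)) where
  contDiff := hF.comp hφ.contDiff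
  hasCompactSupport := hφ.hasCompactSupport.comp_left h0
  tsupport_subset := (closure_mono (Function.support_comp_subset h0 φ)).trans hφ.tsupport_subset

theorem IsTestFunction.exists_bound (hφ : IsTestFunction Ω φ) : ∃ K, ∀ x, ‖φ x‖ ≤ K :=
  hφ.contDiff.continuous.bounded_above_of_compact_support hφ.hasCompactSupport

theorem IsTestFunction.memLp (hφ : IsTestFunction Ω φ) (s : ℝ≥0∞) :
    MemLp φ s (volume.restrict Ω) :=
  (hφ.contDiff.continuous.memLp_of_hasCompactSupport hφ.hasCompactSupport).restrict Ω

theorem IsTestFunction.memLp_gradient (hφ : IsTestFunction Ω φ) (s : ℝ≥0∞) :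
    MemLp (gradient φ) s (volume.restrict Ω) :=
  ((continuous_gradient hφ.contDiff).memLp_of_hasCompactSupport
    (hφ.hasCompactSupport.mono' (support_gradient_subset φ))).restrict Ω

theorem IsTestFunction.integrable_mul {f : EuclideanSpace ℝ (Fin n) → ℝ}
    (hφ : IsTestFunction Ω φ) (hf : LocallyIntegrableOn f Ω) :
    Integrable (fun x => f x * φ x) (volume.restrict Ω) := by
  obtain ⟨K, hK⟩ := hφ.exists_bound
  have hfi : IntegrableOn f (tsupport φ) :=
    hf.integrableOn_compact_subset hφ.tsupport_subset hφ.hasCompactSupport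
  have h : IntegrableOn (fun x => f x * φ x) (tsupport φ) :=
    Integrable.mul_bdd hfi hφ.contDiff.continuous.aestronglyMeasurable (Eventually.of_forall hK)
  rw [integrableOn_iff_integrable_of_support_subset] at h
  · exact h.restrict
  · exact fun x hx => subset_tsupport _ fun h0 => hx (by simp [h0])

end TestFunction

/-! ### Hölder estimates for the field `‖G‖^(p-2) G` -/

theorem memLp_norm_rpow_sub_one {α E : Type*} [MeasurableSpace α] {μ : Measure α}
    [NormedAddCommGroup E] {p : ℝ} {G : α → E} (hp : 1 < p) (hG : MemLp G (ENNReal.ofReal p) μ) :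
    MemLp (fun x => ‖G x‖ ^ (p - 1)) (ENNReal.ofReal (p / (p - 1))) μ := by
  have h := hG.norm_rpow_div (ENNReal.ofReal (p - 1))
  rwa [ENNReal.toReal_ofReal (by linarith), ← ENNReal.ofReal_div_of_pos (by linarith)] at h

theorem holderTriple_div_sub_one {p : ℝ} (hp : 1 < p) :
    ENNReal.HolderTriple (ENNReal.ofReal (p / (p - 1))) (ENNReal.ofReal p) 1 := by
  have h0 : 0 < p - 1 := by linarith
  constructor
  rw [← ENNReal.ofReal_inv_of_pos (by positivity), ← ENNReal.ofReal_inv_of_pos (by positivity),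
    ← ENNReal.ofReal_add (by positivity) (by positivity)]
  rw [inv_one, ← ENNReal.ofReal_one]
  congr 1
  field_simp
  ring

theorem integrable_norm_rpow_mul_norm {α E : Type*} [MeasurableSpace α] {μ : Measure α}
    [NormedAddCommGroup E] {p : ℝ} {G V : α → E} (hp : 1 < p)
    (hG : MemLp G (ENNReal.ofReal p) μ) (hV : MemLp V (ENNReal.ofReal p) μ) :
    Integrable (fun x => ‖G x‖ ^ (p - 1) * ‖V x‖) μ := by
  have := holderTriple_div_sub_one hp
  exact memLp_one_iff_integrable.1 (hV.norm.mul (memLp_norm_rpow_sub_one hp hG))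

section PowerField

variable {α E : Type*} [MeasurableSpace α] {μ : Measure α} [NormedAddCommGroup E]
  [InnerProductSpace ℝ E] {p : ℝ} {G : α → E}

theorem norm_rpow_sub_two_mul_inner_le (hp : 1 < p) (v w : E) :
    ‖‖v‖ ^ (p - 2) * inner ℝ v w‖ ≤ ‖v‖ ^ (p - 1) * ‖w‖ := by
  rw [norm_mul, Real.norm_of_nonneg (by positivity)]
  -- The exponent `p - 2` may be negative or zero, so the power law needs `v ≠ 0`.
  rcases eq_or_ne v 0 with rfl | hv
  · simp [Real.zero_rpow (by linarith : p - 1 ≠ 0)]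
  · have h : ‖v‖ ^ (p - 1) = ‖v‖ ^ (p - 2) * ‖v‖ := by
      rw [← Real.rpow_add_one (norm_ne_zero_iff.2 hv)]; ring_nf
    rw [h, mul_assoc]
    gcongr
    exact norm_inner_le_norm v w

theorem norm_rpow_sub_two_mul_inner_self (hp : 1 < p) (v : E) :
    ‖v‖ ^ (p - 2) * inner ℝ v v = ‖v‖ ^ p := by
  rcases eq_or_ne v 0 with rfl | hv
  · simp [Real.zero_rpow (by linarith : p ≠ 0)]
  · rw [real_inner_self_eq_norm_sq, ← Real.rpow_natCast, ← Real.rpow_add (norm_pos_iff.2 hv)]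
    norm_num

theorem aestronglyMeasurable_norm_rpow_mul_inner {V : α → E} (s : ℝ)
    (hG : AEStronglyMeasurable G μ) (hV : AEStronglyMeasurable V μ) :
    AEStronglyMeasurable (fun x => ‖G x‖ ^ s * inner ℝ (G x) (V x)) μ :=
  (hG.norm.aemeasurable.pow_const s).aestronglyMeasurable.mul (hG.inner hV)

theorem integrable_norm_rpow_mul_inner (hp : 1 < p) (hG : MemLp G (ENNReal.ofReal p) μ)
    {V : α → E} (hV : MemLp V (ENNReal.ofReal p) μ) :
    Integrable (fun x => ‖G x‖ ^ (p - 2) * inner ℝ (G x) (V x)) μ :=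
  (integrable_norm_rpow_mul_norm hp hG hV).mono'
    (aestronglyMeasurable_norm_rpow_mul_inner _ hG.1 hV.1)
    (Eventually.of_forall fun x => norm_rpow_sub_two_mul_inner_le hp (G x) (V x))

/-- Hölder's inequality: `‖G‖^(p-1)` lies in the dual space `L^(p/(p-1))`, so pairing with the field
is continuous on `L^p`. -/
theorem tendsto_integral_norm_rpow_mul_inner_zero (hp : 1 < p)
    (hG : MemLp G (ENNReal.ofReal p) μ) {V : ℕ → α → E}
    (hV : ∀ k, AEStronglyMeasurable (V k) μ)
    (hV0 : Tendsto (fun k => eLpNorm (V k) (ENNReal.ofReal p) μ) atTop (𝓝 0)) :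
    Tendsto (fun k => ∫ x, ‖G x‖ ^ (p - 2) * inner ℝ (G x) (V k x) ∂μ) atTop (𝓝 0) := by
  have := holderTriple_div_sub_one hp
  have hA := memLp_norm_rpow_sub_one hp hG
  rw [tendsto_zero_iff_enorm_tendsto_zero]
  have hlim : Tendsto (fun k => eLpNorm (fun x => ‖G x‖ ^ (p - 1)) (ENNReal.ofReal (p / (p - 1))) μ
      * eLpNorm (V k) (ENNReal.ofReal p) μ) atTop (𝓝 0) := by
    simpa using ENNReal.Tendsto.const_mul hV0 (Or.inr hA.2.ne)
  refine tendsto_of_tendsto_of_tendsto_of_le_of_le tendsto_const_nhds hlim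
    (fun _ => zero_le) fun k => ?_
  refine (enorm_integral_le_lintegral_enorm _).trans ?_
  rw [← eLpNorm_one_eq_lintegral_enorm]
  refine (eLpNorm_mono (g := fun x => ‖G x‖ ^ (p - 1) • V k x) fun x => ?_).trans
    (eLpNorm_smul_le_mul_eLpNorm (hV k) hA.1)
  rw [norm_smul, Real.norm_of_nonneg (by positivity : 0 ≤ ‖G x‖ ^ (p - 1))]
  exact norm_rpow_sub_two_mul_inner_le hp (G x) (V k x)

end PowerField

/-! ### Extending the weak equation to nonlinear functions of `u` -/

section WeakIdentity

variable {n : ℕ} {Ω : Set (EuclideanSpace ℝ (Fin n))} {p : ℝ}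
  {u : EuclideanSpace ℝ (Fin n) → ℝ}
  {G : EuclideanSpace ℝ (Fin n) → EuclideanSpace ℝ (Fin n)}

/-- Convergence in `L^p` gives an a.e. convergent subsequence, as needed to pass to the limit in
`h(φ k)` and `h'(φ k)` by dominated convergence. -/
theorem MemSobolevZero.exists_approx_ae (hp : 1 < p) (hu : MemSobolevZero Ω p u G) :
    ∃ φ : ℕ → EuclideanSpace ℝ (Fin n) → ℝ, (∀ k, IsTestFunction Ω (φ k)) ∧
      (∀ᵐ x ∂(volume.restrict Ω), Tendsto (fun k => φ k x) atTop (𝓝 (u x))) ∧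
      Tendsto (fun k => eLpNorm (fun x => gradient (φ k) x - G x) (ENNReal.ofReal p)
        (volume.restrict Ω)) atTop (𝓝 0) := by
  obtain ⟨φ, hφ, h1, h2⟩ := hu.exists_approx
  have hm := tendstoInMeasure_of_tendsto_eLpNorm (μ := volume.restrict Ω) (f := φ) (g := u)
    (by simp; linarith : ENNReal.ofReal p ≠ 0)
    (fun k => ((hφ k).memLp 1).1) hu.memLp.1 h1
  obtain ⟨ns, hns, hae⟩ := hm.exists_seq_tendsto_ae
  exact ⟨fun k => φ (ns k), fun k => hφ _, hae, h2.comp hns.tendsto_atTop⟩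

/-- A weak identity tested against smooth functions may be tested against `h(u) Φ`, where `h` is
smooth and bounded with bounded derivative and `Φ` is a test function. -/
theorem integral_comp_mul_eq_of_weak (hp : 1 < p) (hu : MemSobolevZero Ω p u G)
    {f : EuclideanSpace ℝ (Fin n) → ℝ} (hf : LocallyIntegrableOn f Ω)
    (hweak : ∀ φ, IsTestFunction Ω φ →
      ∫ x in Ω, ‖G x‖ ^ (p - 2) * inner ℝ (G x) (gradient φ x) = ∫ x in Ω, f x * φ x)
    {h : ℝ → ℝ} (hh : ContDiff ℝ ∞ h) {C : ℝ} (hC : ∀ t, |h t| ≤ C) (hC' : ∀ t, |deriv h t| ≤ C)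
    {Φ : EuclideanSpace ℝ (Fin n) → ℝ} (hΦ : IsTestFunction Ω Φ) :
    ∫ x in Ω, ‖G x‖ ^ (p - 2) *
      inner ℝ (G x) (h (u x) • gradient Φ x + (Φ x * deriv h (u x)) • G x) =
    ∫ x in Ω, f x * (h (u x) * Φ x) := by
  obtain ⟨φ, hφ, hae, hgrad⟩ := hu.exists_approx_ae hp
  obtain ⟨K, hK⟩ := hΦ.exists_bound
  have hK0 : 0 ≤ K := (norm_nonneg _).trans (hK 0)
  have hC0 : 0 ≤ C := (abs_nonneg _).trans (hC 0)
  have hcont_h : Continuous h := hh.continuous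
  have hcont_h' : Continuous (deriv h) := hh.continuous_deriv (by simp)
  have hφm : ∀ k, AEStronglyMeasurable (φ k) (volume.restrict Ω) := fun k => ((hφ k).memLp 1).1
  have hΦm : AEStronglyMeasurable Φ (volume.restrict Ω) := (hΦ.memLp 1).1
  have hgm : ∀ k, MemLp (gradient (φ k)) (ENNReal.ofReal p) (volume.restrict Ω) :=
    fun k => (hφ k).memLp_gradient _
  have hGΦ : MemLp (gradient Φ) (ENNReal.ofReal p) (volume.restrict Ω) := hΦ.memLp_gradient _
  have hfm : AEStronglyMeasurable f (volume.restrict Ω) := hf.aestronglyMeasurable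
  have hfΦ : Integrable (fun x => ‖f x * Φ x‖) (volume.restrict Ω) := (hΦ.integrable_mul hf).norm
  have hR : Tendsto (fun k => ∫ x in Ω, f x * (h (φ k x) * Φ x)) atTop
      (𝓝 (∫ x in Ω, f x * (h (u x) * Φ x))) := by
    refine tendsto_integral_of_dominated_convergence (fun x => C * ‖f x * Φ x‖)
      (fun k => hfm.mul ((hcont_h.comp_aestronglyMeasurable (hφm k)).mul hΦm))
      (hfΦ.const_mul C) (fun k => Eventually.of_forall fun x => ?_) ?_
    · rw [show f x * (h (φ k x) * Φ x) = h (φ k x) * (f x * Φ x) by ring, norm_mul]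
      gcongr
      exact hC _
    · filter_upwards [hae] with x hx
      exact (((hcont_h.tendsto _).comp hx).mul_const _).const_mul _
  -- Writing `∇φ k = G + (∇φ k - G)` isolates a term with a fixed integrable majorant from a
  -- remainder that vanishes by Hölder.
  have hdecomp : ∀ k, ∫ x in Ω, f x * (h (φ k x) * Φ x) =
      (∫ x in Ω, ‖G x‖ ^ (p - 2) *
        inner ℝ (G x) (h (φ k x) • gradient Φ x + (Φ x * deriv h (φ k x)) • G x)) +
      ∫ x in Ω, ‖G x‖ ^ (p - 2) *
        inner ℝ (G x) ((Φ x * deriv h (φ k x)) • (gradient (φ k) x - G x)) := by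
    intro k
    have hb1 : AEStronglyMeasurable (fun x => h (φ k x)) (volume.restrict Ω) :=
      hcont_h.comp_aestronglyMeasurable (hφm k)
    have hb2 : AEStronglyMeasurable (fun x => Φ x * deriv h (φ k x)) (volume.restrict Ω) :=
      hΦm.mul (hcont_h'.comp_aestronglyMeasurable (hφm k))
    have hb2' : ∀ x, ‖Φ x * deriv h (φ k x)‖ ≤ K * C := fun x => by
      rw [norm_mul]
      exact mul_le_mul (hK x) (hC' _) (norm_nonneg _) hK0
    have hbd : ∀ {b : EuclideanSpace ℝ (Fin n) → ℝ}
        {V : EuclideanSpace ℝ (Fin n) → EuclideanSpace ℝ (Fin n)} {M : ℝ},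
        AEStronglyMeasurable b (volume.restrict Ω) → (∀ x, ‖b x‖ ≤ M) →
        MemLp V (ENNReal.ofReal p) (volume.restrict Ω) →
        MemLp (fun x => b x • V x) (ENNReal.ofReal p) (volume.restrict Ω) := by
      intro b V M hb hM hV
      refine hV.of_le_mul (c := M) (hb.smul hV.1) (Eventually.of_forall fun x => ?_)
      rw [norm_smul]
      gcongr
      exact hM x
    have htest : IsTestFunction Ω (fun x => h (φ k x) * Φ x) :=
      hΦ.mul_left (hh.comp (hφ k).contDiff)
    rw [← hweak _ htest, ← integral_add]
    · refine integral_congr_ae (Eventually.of_forall fun x => ?_)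
      have hd1 : DifferentiableAt ℝ h (φ k x) := (hh.differentiable (by simp)) _
      have hd2 : DifferentiableAt ℝ (φ k) x := ((hφ k).contDiff.differentiable (by simp)) _
      have hd3 : DifferentiableAt ℝ Φ x := (hΦ.contDiff.differentiable (by simp)) _
      have hd4 : DifferentiableAt ℝ (fun y => h (φ k y)) x := hd1.comp x hd2
      have hg : gradient (fun y => h (φ k y) * Φ y) x =
          h (φ k x) • gradient Φ x + (Φ x * deriv h (φ k x)) • gradient (φ k) x := by
        rw [gradient_fun_mul hd4 hd3]
        rw [show gradient (fun y => h (φ k y)) x = deriv h (φ k x) • gradient (φ k) x from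
          gradient_fun_comp hd1 hd2, smul_smul]
      simp only [hg]
      rw [← mul_add, ← inner_add_right]
      congr 2
      module
    · exact integrable_norm_rpow_mul_inner hp hu.memLp_grad
        ((hbd hb1 (fun x => hC _) hGΦ).add (hbd hb2 hb2' hu.memLp_grad))
    · exact integrable_norm_rpow_mul_inner hp hu.memLp_grad
        (hbd hb2 hb2' ((hgm k).sub hu.memLp_grad))
  have hL1 : Tendsto (fun k => ∫ x in Ω, ‖G x‖ ^ (p - 2) *
        inner ℝ (G x) (h (φ k x) • gradient Φ x + (Φ x * deriv h (φ k x)) • G x)) atTop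
      (𝓝 (∫ x in Ω, ‖G x‖ ^ (p - 2) *
        inner ℝ (G x) (h (u x) • gradient Φ x + (Φ x * deriv h (u x)) • G x))) := by
    refine tendsto_integral_of_dominated_convergence
      (fun x => C * (‖G x‖ ^ (p - 1) * ‖gradient Φ x‖) + K * C * (‖G x‖ ^ (p - 1) * ‖G x‖))
      (fun k => ?_) ?_ (fun k => Eventually.of_forall fun x => ?_) ?_
    · exact aestronglyMeasurable_norm_rpow_mul_inner _ hu.memLp_grad.1
        (((hcont_h.comp_aestronglyMeasurable (hφm k)).smul hGΦ.1).add
          ((hΦm.mul (hcont_h'.comp_aestronglyMeasurable (hφm k))).smul hu.memLp_grad.1))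
    · exact ((integrable_norm_rpow_mul_norm hp hu.memLp_grad hGΦ).const_mul C).add
        ((integrable_norm_rpow_mul_norm hp hu.memLp_grad hu.memLp_grad).const_mul _)
    · refine (norm_rpow_sub_two_mul_inner_le hp _ _).trans ?_
      have : ‖h (φ k x) • gradient Φ x + (Φ x * deriv h (φ k x)) • G x‖ ≤
          C * ‖gradient Φ x‖ + K * C * ‖G x‖ := by
        refine (norm_add_le _ _).trans ?_
        rw [norm_smul, norm_smul, norm_mul]
        gcongr
        · exact hC _
        · exact hK x
        · exact hC' _
      calc _ ≤ ‖G x‖ ^ (p - 1) * (C * ‖gradient Φ x‖ + K * C * ‖G x‖) := by gcongr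
        _ = _ := by ring
    · filter_upwards [hae] with x hx
      have e1 := (hcont_h.tendsto _).comp hx
      have e2 := (hcont_h'.tendsto _).comp hx
      exact (tendsto_const_nhds.inner ((e1.smul_const _).add
        ((e2.const_mul (Φ x)).smul_const _))).const_mul _
  have hL2 : Tendsto (fun k => ∫ x in Ω, ‖G x‖ ^ (p - 2) *
        inner ℝ (G x) ((Φ x * deriv h (φ k x)) • (gradient (φ k) x - G x))) atTop (𝓝 0) := by
    refine tendsto_integral_norm_rpow_mul_inner_zero hp hu.memLp_grad
      (fun k => (hΦm.mul (hcont_h'.comp_aestronglyMeasurable (hφm k))).smul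
        ((hgm k).1.sub hu.memLp_grad.1)) ?_
    have hlim : Tendsto (fun k => ENNReal.ofReal (K * C) * eLpNorm (fun x => gradient (φ k) x - G x)
        (ENNReal.ofReal p) (volume.restrict Ω)) atTop (𝓝 0) := by
      simpa using ENNReal.Tendsto.const_mul hgrad (Or.inr ENNReal.ofReal_ne_top)
    refine tendsto_of_tendsto_of_tendsto_of_le_of_le tendsto_const_nhds hlim
      (fun _ => zero_le) fun k => ?_
    refine eLpNorm_le_mul_eLpNorm_of_ae_le_mul (Eventually.of_forall fun x => ?_) _
    rw [norm_smul, norm_mul]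
    gcongr
    · exact hK x
    · exact hC' _
  have hL := hL1.add hL2
  simp only [← hdecomp, add_zero] at hL
  exact tendsto_nhds_unique hL hR

end WeakIdentity

/-! ### Young's inequality and the regularized powers -/

theorem mul_rpow_sub_one_mul_le {p X B : ℝ} (hp : 1 < p) (hX : 0 ≤ X) (hB : 0 ≤ B) :
    p * (X ^ (p - 1) * B) ≤ (p - 1) * X ^ p + B ^ p := by
  have h0 : 0 < p - 1 := by linarith
  have hc : (p / (p - 1)).HolderConjugate p := (Real.HolderConjugate.conjExponent hp).symm
  have h := Real.young_inequality_of_nonneg (Real.rpow_nonneg hX (p - 1)) hB hc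
  rw [← Real.rpow_mul hX, show (p - 1) * (p / (p - 1)) = p by field_simp] at h
  have h' := mul_le_mul_of_nonneg_left h (by linarith : 0 ≤ p)
  refine h'.trans (le_of_eq ?_)
  field_simp

/-- A smooth positive regularization of `t ^ 2` near the half-line `0 ≤ t`. -/
def shiftedSq (δ t : ℝ) : ℝ := (1 + δ ^ 2) * ((t + δ) ^ 2 + δ ^ 4)

/-- A smooth bounded regularization of `t ^ (-(p - 1))` on the half-line `0 < t`. -/
def regPow (p δ t : ℝ) : ℝ := shiftedSq δ t ^ (-(p - 1) / 2)

section RegPow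

variable {p δ : ℝ}

theorem sq_add_le_shiftedSq (δ t : ℝ) : (t + δ) ^ 2 ≤ shiftedSq δ t := by
  unfold shiftedSq
  nlinarith [sq_nonneg (δ * (t + δ)), sq_nonneg (δ ^ 2), sq_nonneg (δ ^ 3)]

theorem pow_four_le_shiftedSq (δ t : ℝ) : δ ^ 4 ≤ shiftedSq δ t := by
  unfold shiftedSq
  nlinarith [sq_nonneg (δ * (t + δ)), sq_nonneg (t + δ), sq_nonneg (δ ^ 3)]

theorem shiftedSq_pos (hδ : 0 < δ) (t : ℝ) : 0 < shiftedSq δ t :=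
  (by positivity : 0 < δ ^ 4).trans_le (pow_four_le_shiftedSq δ t)

theorem hasDerivAt_shiftedSq (δ t : ℝ) :
    HasDerivAt (shiftedSq δ) (2 * ((1 + δ ^ 2) * (t + δ))) t := by
  unfold shiftedSq
  have h := ((((hasDerivAt_id t).add_const δ).pow 2).add_const (δ ^ 4)).const_mul (1 + δ ^ 2)
  refine h.congr_deriv ?_
  simp
  ring

theorem contDiff_shiftedSq (δ : ℝ) : ContDiff ℝ ∞ (shiftedSq δ) := by
  unfold shiftedSq
  fun_prop

theorem contDiff_regPow (p : ℝ) (hδ : 0 < δ) : ContDiff ℝ ∞ (regPow p δ) :=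
  (contDiff_shiftedSq δ).rpow_const_of_ne fun t => (shiftedSq_pos hδ t).ne'

theorem regPow_pos (p : ℝ) (hδ : 0 < δ) (t : ℝ) : 0 < regPow p δ t :=
  Real.rpow_pos_of_pos (shiftedSq_pos hδ t) _

theorem regPow_le (hp : 1 < p) (hδ : 0 < δ) (t : ℝ) :
    regPow p δ t ≤ (δ ^ 4) ^ (-(p - 1) / 2) :=
  Real.rpow_le_rpow_of_nonpos (by positivity) (pow_four_le_shiftedSq δ t) (by linarith)

theorem regPow_eq_sqrt (p : ℝ) (hδ : 0 < δ) (t : ℝ) :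
    regPow p δ t = √(shiftedSq δ t) ^ (-(p - 1)) := by
  rw [regPow, Real.sqrt_eq_rpow, ← Real.rpow_mul (shiftedSq_pos hδ t).le]
  ring_nf

theorem deriv_regPow (p : ℝ) (hδ : 0 < δ) (t : ℝ) :
    deriv (regPow p δ) t =
      -((p - 1) * √(shiftedSq δ t) ^ (-p) * ((1 + δ ^ 2) * (t + δ) / √(shiftedSq δ t))) := by
  have hQ := shiftedSq_pos hδ t
  have h := (hasDerivAt_shiftedSq δ t).rpow_const (p := -(p - 1) / 2) (Or.inl hQ.ne')
  have h' : deriv (regPow p δ) t = _ := h.deriv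
  have hs : 0 < √(shiftedSq δ t) := Real.sqrt_pos.2 hQ
  have e : shiftedSq δ t ^ (-(p - 1) / 2 - 1) = √(shiftedSq δ t) ^ (-p) / √(shiftedSq δ t) := by
    rw [← Real.rpow_sub_one hs.ne', Real.sqrt_eq_rpow, ← Real.rpow_mul hQ.le]
    ring_nf
  rw [h', e]
  ring

/-- The floor `δ^4` keeps the base away from zero. The bound covers negative `t` too, because the
approximants of `u` need not be positive. -/
theorem abs_deriv_regPow_le (hp : 1 < p) (hδ : 0 < δ) (t : ℝ) :
    |deriv (regPow p δ) t| ≤ (p - 1) * √(δ ^ 4) ^ (-p) * (1 + δ ^ 2) := by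
  have hQ := shiftedSq_pos hδ t
  have hs : 0 < √(shiftedSq δ t) := Real.sqrt_pos.2 hQ
  have h1 : √(shiftedSq δ t) ^ (-p) ≤ √(δ ^ 4) ^ (-p) :=
    Real.rpow_le_rpow_of_nonpos (Real.sqrt_pos.2 (by positivity))
      (Real.sqrt_le_sqrt (pow_four_le_shiftedSq δ t)) (by linarith)
  have h2 : |(1 + δ ^ 2) * (t + δ) / √(shiftedSq δ t)| ≤ 1 + δ ^ 2 := by
    rw [abs_div, abs_mul, abs_of_pos hs, abs_of_pos (by positivity : 0 < 1 + δ ^ 2),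
      div_le_iff₀ hs]
    gcongr
    exact Real.abs_le_sqrt (sq_add_le_shiftedSq δ t)
  have h3 : 0 < p - 1 := by linarith
  rw [deriv_regPow p hδ, abs_neg, abs_mul, abs_mul, abs_of_pos h3,
    abs_of_pos (Real.rpow_pos_of_pos hs _)]
  gcongr

/-- With `σ = √(shiftedSq δ t)`, this says `σ' ≥ 1`, the sharp form that Picone's cancellation
requires. The factor `1 + δ^2` and the shift by `δ` in `shiftedSq` serve this: the claim reduces to
`δ^2 ≤ (t + δ)^2`. -/
theorem deriv_regPow_le (hp : 1 < p) (hδ : 0 < δ) {t : ℝ} (ht : 0 ≤ t) :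
    deriv (regPow p δ) t ≤ -((p - 1) * √(shiftedSq δ t) ^ (-p)) := by
  have hQ := shiftedSq_pos hδ t
  have hs : 0 < √(shiftedSq δ t) := Real.sqrt_pos.2 hQ
  rw [deriv_regPow p hδ, neg_le_neg_iff]
  refine le_mul_of_one_le_right (mul_nonneg (by linarith) (by positivity)) ?_
  rw [one_le_div hs]
  refine Real.sqrt_le_iff.2 ⟨by positivity, ?_⟩
  have h1 : δ ^ 2 ≤ (t + δ) ^ 2 := by gcongr; linarith
  have h2 : δ ^ 2 * δ ^ 2 ≤ δ ^ 2 * (t + δ) ^ 2 := by gcongr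
  unfold shiftedSq
  rw [mul_pow, sq (1 + δ ^ 2), mul_assoc]
  gcongr
  nlinarith

theorem rpow_mul_regPow_le_one (hp : 1 < p) (hδ : 0 < δ) {t : ℝ} (ht : 0 ≤ t) :
    t ^ (p - 1) * regPow p δ t ≤ 1 := by
  have hs : 0 < √(shiftedSq δ t) := Real.sqrt_pos.2 (shiftedSq_pos hδ t)
  have h1 : t ≤ √(shiftedSq δ t) := by
    have := Real.le_sqrt_of_sq_le (sq_add_le_shiftedSq δ t)
    linarith
  rw [regPow_eq_sqrt p hδ, Real.rpow_neg hs.le, ← div_eq_mul_inv]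
  exact div_le_one_of_le₀ (Real.rpow_le_rpow ht h1 (by linarith)) (by positivity)

theorem tendsto_rpow_mul_regPow (p : ℝ) {t : ℝ} (ht : 0 < t) :
    Tendsto (fun δ => t ^ (p - 1) * regPow p δ t) (𝓝[>] 0) (𝓝 1) := by
  have hc : ContinuousAt (fun δ => t ^ (p - 1) * regPow p δ t) 0 := by
    unfold regPow
    refine continuousAt_const.mul (ContinuousAt.rpow_const ?_ (Or.inl ?_))
    · unfold shiftedSq
      fun_prop
    · simp [shiftedSq, ht.ne']
  have h : t ^ (p - 1) * regPow p 0 t = 1 := by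
    have e : shiftedSq 0 t = t ^ (2 : ℝ) := by simp [shiftedSq]
    rw [regPow, e, ← Real.rpow_mul ht.le, ← Real.rpow_add ht]
    ring_nf
    simp
  have := hc.tendsto
  rw [h] at this
  exact this.mono_left nhdsWithin_le_nhds

end RegPow

/-- A smooth regularization of `|s| ^ p` vanishing at the origin. -/
def regAbs (p η s : ℝ) : ℝ := (s ^ 2 + η ^ 2) ^ (p / 2) - η ^ p

section RegAbs

variable {p η : ℝ}

theorem sq_add_sq_rpow (p : ℝ) (η s : ℝ) :
    (s ^ 2 + η ^ 2) ^ (p / 2) = √(s ^ 2 + η ^ 2) ^ p := by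
  rw [Real.sqrt_eq_rpow, ← Real.rpow_mul (by positivity)]
  ring_nf

theorem contDiff_regAbs (p : ℝ) (hη : 0 < η) : ContDiff ℝ ∞ (regAbs p η) := by
  unfold regAbs
  refine ContDiff.sub (ContDiff.rpow_const_of_ne (by fun_prop) fun s => ?_) contDiff_const
  positivity

/-- Subtracting `η^p` makes composition with a test function preserve compact support. -/
theorem regAbs_zero (p : ℝ) (hη : 0 < η) : regAbs p η 0 = 0 := by
  rw [regAbs, sq_add_sq_rpow]
  simp [Real.sqrt_sq hη.le]

theorem regAbs_nonneg (hp : 1 < p) (hη : 0 < η) (s : ℝ) : 0 ≤ regAbs p η s := by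
  rw [regAbs, sq_add_sq_rpow, sub_nonneg]
  refine Real.rpow_le_rpow hη.le (Real.le_sqrt_of_sq_le ?_) (by linarith)
  nlinarith [sq_nonneg s]

theorem abs_rpow_sub_le_regAbs (hp : 1 < p) (η s : ℝ) : |s| ^ p - η ^ p ≤ regAbs p η s := by
  rw [regAbs, sq_add_sq_rpow]
  gcongr
  refine Real.abs_le_sqrt ?_
  nlinarith [sq_nonneg η]

theorem abs_deriv_regAbs_le (hp : 1 < p) (hη : 0 < η) (s : ℝ) :
    |deriv (regAbs p η) s| ≤ p * √(s ^ 2 + η ^ 2) ^ (p - 1) := by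
  have hQ : 0 < s ^ 2 + η ^ 2 := by positivity
  have hm : 0 < √(s ^ 2 + η ^ 2) := Real.sqrt_pos.2 hQ
  have h := (((((hasDerivAt_id s).pow 2).add_const (η ^ 2)).rpow_const (p := p / 2)
    (Or.inl (by simpa using hQ.ne'))).sub_const (η ^ p))
  have h' : deriv (regAbs p η) s = _ := h.deriv
  have e : (s ^ 2 + η ^ 2) ^ (p / 2 - 1) = √(s ^ 2 + η ^ 2) ^ (p - 1) / √(s ^ 2 + η ^ 2) := by
    rw [← Real.rpow_sub_one hm.ne', Real.sqrt_eq_rpow, ← Real.rpow_mul hQ.le]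
    ring_nf
  have h2 : deriv (regAbs p η) s =
      p * √(s ^ 2 + η ^ 2) ^ (p - 1) * (s / √(s ^ 2 + η ^ 2)) := by
    rw [h']
    simp only [id, Pi.pow_apply]
    rw [e]
    simp
    ring
  rw [h2, abs_mul, abs_of_pos (by positivity : 0 < p * √(s ^ 2 + η ^ 2) ^ (p - 1))]
  refine mul_le_of_le_one_right (by positivity) ?_
  rw [abs_div, abs_of_pos hm]
  refine div_le_one_of_le₀ (Real.abs_le_sqrt ?_) hm.le
  nlinarith [sq_nonneg η]

end RegAbs

/-! ### The regularized Picone inequality -/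

/-- The pointwise Picone-type inequality behind the comparison with the first eigenvalue. -/
theorem norm_rpow_mul_inner_regPow_le {E : Type*} [NormedAddCommGroup E] [InnerProductSpace ℝ E]
    {p δ η t s : ℝ} (hp : 1 < p) (hδ : 0 < δ) (hη : 0 < η) (ht : 0 ≤ t) (v w : E) :
    ‖v‖ ^ (p - 2) * inner ℝ v (regPow p δ t • (deriv (regAbs p η) s • w) +
      (regAbs p η s * deriv (regPow p δ) t) • v) ≤
    ‖w‖ ^ p + (p - 1) * √(δ ^ 4) ^ (-p) * (1 + δ ^ 2) * η ^ p * ‖v‖ ^ p := by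
  have hp0 : 0 < p - 1 := by linarith
  set m := √(s ^ 2 + η ^ 2) with hm
  set σ := √(shiftedSq δ t) with hσ
  have hσ0 : 0 < σ := Real.sqrt_pos.2 (shiftedSq_pos hδ t)
  have hm0 : 0 < m := Real.sqrt_pos.2 (by positivity)
  rw [inner_add_right, mul_add]
  rw [inner_smul_right v v, mul_left_comm, norm_rpow_sub_two_mul_inner_self hp]
  have h1 : ‖v‖ ^ (p - 2) * inner ℝ v (regPow p δ t • (deriv (regAbs p η) s • w)) ≤
      p * ((‖v‖ * m / σ) ^ (p - 1) * ‖w‖) := by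
    refine (le_abs_self _).trans ((norm_rpow_sub_two_mul_inner_le hp v _).trans ?_)
    rw [norm_smul, norm_smul, Real.norm_of_nonneg (regPow_pos p hδ t).le, Real.norm_eq_abs,
      regPow_eq_sqrt p hδ, Real.div_rpow (by positivity) hσ0.le,
      Real.mul_rpow (norm_nonneg _) hm0.le, ← hσ, Real.rpow_neg hσ0.le]
    calc ‖v‖ ^ (p - 1) * ((σ ^ (p - 1))⁻¹ * (|deriv (regAbs p η) s| * ‖w‖))
        ≤ ‖v‖ ^ (p - 1) * ((σ ^ (p - 1))⁻¹ * (p * m ^ (p - 1) * ‖w‖)) := by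
          gcongr
          exact abs_deriv_regAbs_le hp hη s
      _ = _ := by ring
  -- The term `(p - 1) X^p` produced by Young is cancelled by `m^p` times the derivative bound `h3`;
  -- the part `-η^p` of `regAbs` leaves the error controlled by `h4`.
  have h2 := mul_rpow_sub_one_mul_le hp (by positivity : 0 ≤ ‖v‖ * m / σ) (norm_nonneg w)
  have e2 : (‖v‖ * m / σ) ^ p = ‖v‖ ^ p * m ^ p * σ ^ (-p) := by
    rw [Real.div_rpow (by positivity) hσ0.le, Real.mul_rpow (norm_nonneg _) hm0.le,
      Real.rpow_neg hσ0.le]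
    rfl
  have h3 := deriv_regPow_le hp hδ ht
  have h4 := (neg_le_abs _).trans (abs_deriv_regPow_le hp hδ t)
  have e4 : regAbs p η s = m ^ p - η ^ p := by rw [regAbs, sq_add_sq_rpow]
  have h5 : m ^ p * deriv (regPow p δ) t * ‖v‖ ^ p ≤
      m ^ p * (-((p - 1) * σ ^ (-p))) * ‖v‖ ^ p := by gcongr
  have h6 : η ^ p * (-deriv (regPow p δ) t) * ‖v‖ ^ p ≤
      η ^ p * ((p - 1) * √(δ ^ 4) ^ (-p) * (1 + δ ^ 2)) * ‖v‖ ^ p := by gcongr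
  rw [e2] at h2
  rw [e4]
  linarith

/-! ### Lower bound for the Rayleigh quotient -/

section Rayleigh

variable {n : ℕ} {Ω : Set (EuclideanSpace ℝ (Fin n))} {p μ : ℝ}
  {u f φ : EuclideanSpace ℝ (Fin n) → ℝ}
  {G : EuclideanSpace ℝ (Fin n) → EuclideanSpace ℝ (Fin n)}

theorem integrable_norm_rpow {E : Type*} [NormedAddCommGroup E]
    {V : EuclideanSpace ℝ (Fin n) → E} (hp : 1 < p)
    (hV : MemLp V (ENNReal.ofReal p) (volume.restrict Ω)) :
    Integrable (fun x => ‖V x‖ ^ p) (volume.restrict Ω) := by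
  have h := hV.integrable_norm_rpow (by simp; linarith) ENNReal.ofReal_ne_top
  rwa [ENNReal.toReal_ofReal (by linarith)] at h

/-- Test with `regPow p δ (u) * regAbs p η (φ)`, using Picone on the left and `f ≥ μ u^(p-1)` on the
right. All losses carry a factor `η^p` whose coefficient is independent of `η`. -/
theorem regularized_rayleigh_le (hΩb : Bornology.IsBounded Ω) (hp : 1 < p)
    (hu : MemSobolevZero Ω p u G) (hpos : ∀ᵐ x ∂(volume.restrict Ω), 0 < u x)
    (hf : LocallyIntegrableOn f Ω)
    (hweak : ∀ φ, IsTestFunction Ω φ →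
      ∫ x in Ω, ‖G x‖ ^ (p - 2) * inner ℝ (G x) (gradient φ x) = ∫ x in Ω, f x * φ x)
    (hμ : 0 ≤ μ) (hfμ : ∀ᵐ x ∂(volume.restrict Ω), μ * u x ^ (p - 1) ≤ f x)
    (hφ : IsTestFunction Ω φ) {δ η : ℝ} (hδ : 0 < δ) (hη : 0 < η) :
    μ * ∫ x in Ω, u x ^ (p - 1) * regPow p δ (u x) * |φ x| ^ p ≤
      (∫ x in Ω, ‖gradient φ x‖ ^ p) +
      η ^ p * ((p - 1) * √(δ ^ 4) ^ (-p) * (1 + δ ^ 2) * (∫ x in Ω, ‖G x‖ ^ p) +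
        μ * volume.real Ω) := by
  have : IsFiniteMeasure (volume.restrict Ω) := ⟨by simpa using hΩb.measure_lt_top⟩
  have hφp : Integrable (fun x => |φ x| ^ p) (volume.restrict Ω) :=
    integrable_norm_rpow hp (hφ.memLp _)
  have hgp := integrable_norm_rpow hp (hφ.memLp_gradient (Ω := Ω) (ENNReal.ofReal p))
  have hGp := integrable_norm_rpow hp hu.memLp_grad
  have hreg := (contDiff_regPow p hδ).continuous
  have hum : AEStronglyMeasurable (fun x => regPow p δ (u x)) (volume.restrict Ω) :=
    hreg.comp_aestronglyMeasurable hu.memLp.1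
  have hΦ : IsTestFunction Ω (fun x => regAbs p η (φ x)) :=
    hφ.comp_left (contDiff_regAbs p hη) (regAbs_zero p hη)
  have hw : Integrable (fun x => u x ^ (p - 1) * regPow p δ (u x) * |φ x| ^ p)
      (volume.restrict Ω) := by
    refine hφp.bdd_mul (c := 1) ((hu.memLp.1.aemeasurable.pow_const _).aestronglyMeasurable.mul hum)
      ?_
    filter_upwards [hpos] with x hx
    rw [Real.norm_of_nonneg (mul_nonneg (by positivity) (regPow_pos p hδ _).le)]
    exact rpow_mul_regPow_le_one hp hδ hx.le
  have hid := integral_comp_mul_eq_of_weak hp hu hf hweak (contDiff_regPow p hδ)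
    (C := max ((δ ^ 4) ^ (-(p - 1) / 2)) ((p - 1) * √(δ ^ 4) ^ (-p) * (1 + δ ^ 2)))
    (fun t => by
      rw [abs_of_pos (regPow_pos p hδ t)]
      exact (regPow_le hp hδ t).trans (le_max_left _ _))
    (fun t => (abs_deriv_regPow_le hp hδ t).trans (le_max_right _ _)) hΦ
  set M := (p - 1) * √(δ ^ 4) ^ (-p) * (1 + δ ^ 2) with hM
  have hM0 : 0 ≤ M := (abs_nonneg _).trans (abs_deriv_regPow_le hp hδ 0)
  have hleft : ∫ x in Ω, ‖G x‖ ^ (p - 2) *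
      inner ℝ (G x) (regPow p δ (u x) • gradient (fun x => regAbs p η (φ x)) x +
        (regAbs p η (φ x) * deriv (regPow p δ) (u x)) • G x) ≤
      ∫ x in Ω, (‖gradient φ x‖ ^ p + M * η ^ p * ‖G x‖ ^ p) := by
    -- A non-integrable function has integral `0` by convention, which the nonnegative majorant
    -- still bounds.
    by_cases hi : Integrable (fun x => ‖G x‖ ^ (p - 2) *
      inner ℝ (G x) (regPow p δ (u x) • gradient (fun x => regAbs p η (φ x)) x +
        (regAbs p η (φ x) * deriv (regPow p δ) (u x)) • G x)) (volume.restrict Ω)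
    · refine integral_mono_ae hi (hgp.add (hGp.const_mul _)) ?_
      filter_upwards [hpos] with x hx
      have hd : gradient (fun x => regAbs p η (φ x)) x =
          deriv (regAbs p η) (φ x) • gradient φ x :=
        gradient_fun_comp ((contDiff_regAbs p hη).differentiable (by simp) _)
          (hφ.contDiff.differentiable (by simp) _)
      rw [hd]
      exact norm_rpow_mul_inner_regPow_le hp hδ hη hx.le (G x) (gradient φ x)
    · rw [integral_undef hi]
      positivity
  have hright : ∫ x in Ω, (μ * (u x ^ (p - 1) * regPow p δ (u x) * |φ x| ^ p) - μ * η ^ p) ≤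
      ∫ x in Ω, f x * (regPow p δ (u x) * regAbs p η (φ x)) := by
    refine integral_mono_ae ((hw.const_mul μ).sub (integrable_const _)) ?_ ?_
    · have h := (hΦ.integrable_mul hf).bdd_mul (c := (δ ^ 4) ^ (-(p - 1) / 2)) hum
        (Eventually.of_forall fun x => by
          rw [Real.norm_of_nonneg (regPow_pos p hδ _).le]
          exact regPow_le hp hδ _)
      refine h.congr (Eventually.of_forall fun x => ?_)
      simp only
      ring
    · filter_upwards [hpos, hfμ] with x hx hfx
      have h0 := (regPow_pos p hδ (u x)).le
      have h1 := rpow_mul_regPow_le_one hp hδ hx.le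
      have h2 := abs_rpow_sub_le_regAbs hp η (φ x)
      have h3 := regAbs_nonneg hp hη (φ x)
      have h4 : 0 ≤ μ * (u x ^ (p - 1) * regPow p δ (u x)) := by positivity
      calc μ * (u x ^ (p - 1) * regPow p δ (u x) * |φ x| ^ p) - μ * η ^ p
          ≤ μ * (u x ^ (p - 1) * regPow p δ (u x) * |φ x| ^ p) -
            μ * η ^ p * (u x ^ (p - 1) * regPow p δ (u x)) :=
            sub_le_sub_left (mul_le_of_le_one_right (by positivity) h1) _
        _ = μ * (u x ^ (p - 1) * regPow p δ (u x)) * (|φ x| ^ p - η ^ p) := by ring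
        _ ≤ μ * (u x ^ (p - 1) * regPow p δ (u x)) * regAbs p η (φ x) := by gcongr
        _ = μ * u x ^ (p - 1) * (regPow p δ (u x) * regAbs p η (φ x)) := by ring
        _ ≤ f x * (regPow p δ (u x) * regAbs p η (φ x)) := by gcongr
  have h := hright.trans (hid.symm.le.trans hleft)
  rw [integral_sub (hw.const_mul μ) (integrable_const _), integral_const_mul, integral_const,
    integral_add hgp (hGp.const_mul _), integral_const_mul, smul_eq_mul,
    measureReal_restrict_apply_univ] at h
  linarith

/-- A positive function satisfying `-Δ_p u ≥ μ u ^ (p - 1)` weakly bounds the Rayleigh quotient of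
test functions from below by `μ`. -/
theorem mul_integral_rpow_le_of_weak (hΩb : Bornology.IsBounded Ω) (hp : 1 < p)
    (hu : MemSobolevZero Ω p u G) (hpos : ∀ᵐ x ∂(volume.restrict Ω), 0 < u x)
    (hf : LocallyIntegrableOn f Ω)
    (hweak : ∀ φ, IsTestFunction Ω φ →
      ∫ x in Ω, ‖G x‖ ^ (p - 2) * inner ℝ (G x) (gradient φ x) = ∫ x in Ω, f x * φ x)
    (hμ : 0 ≤ μ) (hfμ : ∀ᵐ x ∂(volume.restrict Ω), μ * u x ^ (p - 1) ≤ f x)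
    (hφ : IsTestFunction Ω φ) :
    μ * ∫ x in Ω, |φ x| ^ p ≤ ∫ x in Ω, ‖gradient φ x‖ ^ p := by
  have hφp : Integrable (fun x => |φ x| ^ p) (volume.restrict Ω) :=
    integrable_norm_rpow hp (hφ.memLp _)
  -- The error coefficient may blow up as `δ → 0`, so `η → 0` is taken first with `δ` fixed.
  have hδ : ∀ δ : ℝ, 0 < δ → μ * ∫ x in Ω, u x ^ (p - 1) * regPow p δ (u x) * |φ x| ^ p ≤
      ∫ x in Ω, ‖gradient φ x‖ ^ p := by
    intro δ hδ
    set D := (p - 1) * √(δ ^ 4) ^ (-p) * (1 + δ ^ 2) * (∫ x in Ω, ‖G x‖ ^ p) + μ * volume.real Ω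
    have hlim : Tendsto (fun η : ℝ => (∫ x in Ω, ‖gradient φ x‖ ^ p) + η ^ p * D) (𝓝[>] 0)
        (𝓝 ((∫ x in Ω, ‖gradient φ x‖ ^ p) + 0 ^ p * D)) := by
      have hc : ContinuousAt (fun η : ℝ => (∫ x in Ω, ‖gradient φ x‖ ^ p) + η ^ p * D) 0 := by
        have := Real.continuousAt_rpow_const (0 : ℝ) p (Or.inr (by linarith))
        fun_prop
      exact hc.tendsto.mono_left nhdsWithin_le_nhds
    rw [Real.zero_rpow (by linarith), zero_mul, add_zero] at hlim
    refine ge_of_tendsto hlim ?_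
    filter_upwards [self_mem_nhdsWithin] with η hη
    exact regularized_rayleigh_le hΩb hp hu hpos hf hweak hμ hfμ hφ hδ hη
  have hlim : Tendsto (fun δ : ℝ => ∫ x in Ω, u x ^ (p - 1) * regPow p δ (u x) * |φ x| ^ p)
      (𝓝[>] 0) (𝓝 (∫ x in Ω, |φ x| ^ p)) := by
    refine tendsto_integral_filter_of_dominated_convergence (fun x => |φ x| ^ p) ?_ ?_ hφp ?_
    · filter_upwards [self_mem_nhdsWithin] with δ hδ
      exact ((hu.memLp.1.aemeasurable.pow_const _).aestronglyMeasurable.mul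
        ((contDiff_regPow p hδ).continuous.comp_aestronglyMeasurable hu.memLp.1)).mul hφp.1
    · filter_upwards [self_mem_nhdsWithin] with δ hδ
      filter_upwards [hpos] with x hx
      have h0 := (regPow_pos p hδ (u x)).le
      rw [Real.norm_of_nonneg (by positivity)]
      exact mul_le_of_le_one_left (by positivity) (rpow_mul_regPow_le_one hp hδ hx.le)
    · filter_upwards [hpos] with x hx
      simpa using (tendsto_rpow_mul_regPow p hx).mul_const (|φ x| ^ p)
  refine le_of_tendsto (hlim.const_mul μ) ?_
  filter_upwards [self_mem_nhdsWithin] with δ h0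
  exact hδ δ h0

theorem integral_norm_rpow_eq {E : Type*} [NormedAddCommGroup E]
    {V : EuclideanSpace ℝ (Fin n) → E} (hp : 1 < p)
    (hV : MemLp V (ENNReal.ofReal p) (volume.restrict Ω)) :
    ∫ x in Ω, ‖V x‖ ^ p = (eLpNorm V (ENNReal.ofReal p) (volume.restrict Ω)).toReal ^ p := by
  have h0 : ENNReal.ofReal p ≠ 0 := by simp; linarith
  have hp0 : 0 ≤ p := by linarith
  rw [hV.eLpNorm_eq_integral_rpow_norm h0 ENNReal.ofReal_ne_top, ENNReal.toReal_ofReal hp0,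
    ENNReal.toReal_ofReal (by positivity), ← Real.rpow_mul (by positivity),
    inv_mul_cancel₀ (by linarith), Real.rpow_one]

theorem tendsto_integral_norm_rpow {E : Type*} [NormedAddCommGroup E]
    {V : EuclideanSpace ℝ (Fin n) → E} {W : ℕ → EuclideanSpace ℝ (Fin n) → E} (hp : 1 < p)
    (hV : MemLp V (ENNReal.ofReal p) (volume.restrict Ω))
    (hW : ∀ k, MemLp (W k) (ENNReal.ofReal p) (volume.restrict Ω))
    (h : Tendsto (fun k => eLpNorm (fun x => W k x - V x) (ENNReal.ofReal p)
      (volume.restrict Ω)) atTop (𝓝 0)) :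
    Tendsto (fun k => ∫ x in Ω, ‖W k x‖ ^ p) atTop (𝓝 (∫ x in Ω, ‖V x‖ ^ p)) := by
  have h1 : 1 ≤ ENNReal.ofReal p := by simpa using hp.le
  have : Fact (1 ≤ ENNReal.ofReal p) := ⟨h1⟩
  have hL : Tendsto (fun k => (hW k).toLp) atTop (𝓝 hV.toLp) :=
    (Lp.tendsto_Lp_iff_tendsto_eLpNorm'' W hW V hV).2 h
  simp only [integral_norm_rpow_eq hp hV, fun k => integral_norm_rpow_eq hp (hW k)]
  have hn := hL.norm
  simp only [Lp.norm_toLp] at hn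
  exact hn.rpow_const (Or.inr (by linarith))

/-- Both integrals are continuous along the `W^{1,p}` approximation. A nonzero element is required
because the real infimum of the empty set is `0`. -/
theorem le_firstEigenvalue_of_test (hp : 1 < p)
    (hne : ∃ u G, MemSobolevZero Ω p u G ∧ ¬ (u =ᵐ[volume.restrict Ω] 0))
    (h : ∀ φ, IsTestFunction Ω φ →
      μ * ∫ x in Ω, |φ x| ^ p ≤ ∫ x in Ω, ‖gradient φ x‖ ^ p) :
    μ ≤ firstEigenvalue Ω p := by
  obtain ⟨u₀, G₀, h₀, h₀'⟩ := hne
  refine le_csInf ⟨_, u₀, G₀, h₀, h₀', rfl⟩ ?_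
  rintro _ ⟨u, G, hu, hu0, rfl⟩
  obtain ⟨φ, hφ, h1, h2⟩ := hu.exists_approx
  have hlim1 := tendsto_integral_norm_rpow hp hu.memLp (fun k => (hφ k).memLp _) h1
  have hlim2 := tendsto_integral_norm_rpow hp hu.memLp_grad (fun k => (hφ k).memLp_gradient _) h2
  have hle := le_of_tendsto_of_tendsto' (hlim1.const_mul μ) hlim2 fun k => h _ (hφ k)
  have hpos : 0 < ∫ x in Ω, |u x| ^ p := by
    refine (integral_nonneg fun x => by positivity).lt_of_ne' fun h0 => hu0 ?_
    have hi := integrable_norm_rpow hp hu.memLp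
    have h0' := (integral_eq_zero_iff_of_nonneg (fun x => by positivity) hi).1 h0
    filter_upwards [h0'] with x hx
    have hx' : ‖u x‖ ^ p = 0 := hx
    rw [Real.rpow_eq_zero (norm_nonneg _) (by linarith)] at hx'
    simpa using hx'
  exact (le_div_iff₀ hpos).2 hle

theorem firstEigenvalue_nonneg (Ω : Set (EuclideanSpace ℝ (Fin n))) (p : ℝ) :
    0 ≤ firstEigenvalue Ω p := by
  refine Real.sInf_nonneg ?_
  rintro _ ⟨u, G, -, -, rfl⟩
  positivity

end Rayleigh

/-! ### The explicit threshold and its limit -/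

section Threshold

variable {n : ℕ} {Ω : Set (EuclideanSpace ℝ (Fin n))} {p q r Λ : ℝ}

/-- AM-GM with weights `a`, `b` chosen so that `(q-1) a + (r-1) b = p-1`. The resulting constant is
`μ = (Λ/a)^a (1/b)^b`; solving `μ = l` for `Λ` gives the explicit threshold, written `a (l
b^b)^(1/a)`. -/
theorem exists_mul_rpow_le (hqp : q < p) (hpr : p < r) {l : ℝ} (hl : 0 ≤ l)
    (hΛ : l ^ ((r - q) / (r - p)) * (r - p) *
      ((p - q) ^ (p - q) / (r - q) ^ (r - q)) ^ (1 / (r - p)) < Λ) :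
    ∃ μ, l < μ ∧ ∀ t : ℝ, 0 < t → μ * t ^ (p - 1) ≤ Λ * t ^ (q - 1) + t ^ (r - 1) := by
  have h1 : 0 < r - p := by linarith
  have h2 : 0 < p - q := by linarith
  have h3 : 0 < r - q := by linarith
  set a := (r - p) / (r - q) with ha
  set b := (p - q) / (r - q) with hb
  have ha0 : 0 < a := by positivity
  have hb0 : 0 < b := by positivity
  have hab : a + b = 1 := by rw [ha, hb, ← add_div]; field_simp; ring
  have hΛ0 : 0 < Λ := lt_of_le_of_lt (by positivity) hΛ
  have e : l ^ ((r - q) / (r - p)) * (r - p) *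
      ((p - q) ^ (p - q) / (r - q) ^ (r - q)) ^ (1 / (r - p)) =
      a * (l * b ^ b) ^ (a⁻¹) := by
    have e1 : (r - q) / (r - p) = a⁻¹ := by rw [ha, inv_div]
    have e2 : b * a⁻¹ = (p - q) / (r - p) := by rw [ha, hb]; field_simp
    have e3 : (r - q) * (1 / (r - p)) = 1 + (p - q) / (r - p) := by field_simp; ring
    rw [Real.mul_rpow hl (by positivity), ← Real.rpow_mul hb0.le, e1, e2,
      Real.div_rpow (by positivity) (by positivity), ← Real.rpow_mul h2.le, ← Real.rpow_mul h3.le,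
      e3, Real.rpow_add h3, Real.rpow_one, hb, ha, Real.div_rpow h2.le h3.le, mul_one_div]
    field_simp
  rw [e] at hΛ
  refine ⟨(Λ / a) ^ a * (1 / b) ^ b, ?_, fun t ht => ?_⟩
  · have h4 : (l * b ^ b) ^ a⁻¹ < Λ / a := by rwa [lt_div_iff₀' ha0]
    have h5 := Real.rpow_lt_rpow (by positivity) h4 ha0
    rw [← Real.rpow_mul (by positivity), inv_mul_cancel₀ ha0.ne', Real.rpow_one] at h5
    rw [Real.div_rpow zero_le_one hb0.le, Real.one_rpow, mul_one_div]
    rwa [lt_div_iff₀ (by positivity)]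
  · have h := Real.geom_mean_le_arith_mean2_weighted ha0.le hb0.le
      (by positivity : 0 ≤ Λ * t ^ (q - 1) / a) (by positivity : 0 ≤ t ^ (r - 1) / b) hab
    rw [mul_div_cancel₀ _ ha0.ne', mul_div_cancel₀ _ hb0.ne'] at h
    refine le_trans (le_of_eq ?_) h
    have e4 : p - 1 = (q - 1) * a + (r - 1) * b := by
      rw [ha, hb]; field_simp; ring
    rw [e4, Real.rpow_add ht, Real.rpow_mul ht.le, Real.rpow_mul ht.le, mul_div_right_comm,
      Real.mul_rpow (by positivity) (by positivity), ← one_div_mul_eq_div b (t ^ (r - 1)),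
      Real.mul_rpow (x := 1 / b) (by positivity) (by positivity)]
    ring

theorem not_exists_isPositiveWeakSolution (hΩ_open : IsOpen Ω) (hΩ_ne : Ω.Nonempty)
    (hΩb : Bornology.IsBounded Ω) (hp : 1 < p) (hqp : q < p) (hpr : p < r)
    (hΛ : upperThreshold Ω p q r < Λ) : ¬ ∃ u, IsPositiveWeakSolution Ω p q r Λ u := by
  rintro ⟨u, hpos, hf, G, hu, hweak⟩
  obtain ⟨μ, hμ, hμt⟩ := exists_mul_rpow_le hqp hpr (firstEigenvalue_nonneg Ω p) hΛ
  refine hμ.not_ge (le_firstEigenvalue_of_test hp ⟨u, G, hu, fun h0 => ?_⟩ fun φ hφ => ?_)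
  -- The solution itself is the nonzero element: `u > 0` and `u = 0` cannot both hold a.e. on a
  -- nonempty open set.
  · have hfalse : ∀ᵐ x ∂(volume.restrict Ω), False := by
      filter_upwards [hpos, h0] with x hx hx0
      exact hx.ne' hx0
    have h := ae_iff.1 hfalse
    simp only [not_false_eq_true, Set.ofPred_true, Measure.restrict_apply_univ] at h
    exact (hΩ_open.measure_pos volume hΩ_ne).ne' h
  · refine mul_integral_rpow_le_of_weak hΩb hp hu hpos hf hweak
      ((firstEigenvalue_nonneg Ω p).trans hμ.le) ?_ hφ
    filter_upwards [hpos] with x hx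
    exact hμt _ hx

theorem existenceThreshold_le (hΩ_open : IsOpen Ω) (hΩ_ne : Ω.Nonempty)
    (hΩb : Bornology.IsBounded Ω) (hp : 1 < p) (hqp : q < p) (hpr : p < r) :
    existenceThreshold Ω p q r ≤ ENNReal.ofReal (upperThreshold Ω p q r) := by
  refine sSup_le ?_
  rintro _ ⟨Λ, -, hu, rfl⟩
  refine ENNReal.ofReal_le_ofReal (not_lt.1 fun hlt => ?_)
  exact not_exists_isPositiveWeakSolution hΩ_open hΩ_ne hΩb hp hqp hpr hlt hu

theorem tendsto_upperThreshold (Ω : Set (EuclideanSpace ℝ (Fin n))) (hpr : p < r) :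
    Tendsto (fun q => upperThreshold Ω p q r) (𝓝[<] p) (𝓝 (firstEigenvalue Ω p)) := by
  have h1 : 0 < r - p := by linarith
  -- `x^x = exp(x log x)` for `x > 0`, and the conventional value `0^0 = 1` agrees with the limit at
  -- `0`.
  have hpow : ContinuousWithinAt (fun q : ℝ => (p - q) ^ (p - q)) (Set.Iio p) p := by
    have hc : Continuous fun q : ℝ => Real.exp ((p - q) * Real.log (p - q)) :=
      Real.continuous_exp.comp (Real.continuous_mul_log.comp (by fun_prop))
    refine hc.continuousWithinAt.congr (fun q hq => ?_) (by simp)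
    rw [Real.rpow_def_of_pos (sub_pos.2 hq), mul_comm]
  have hc : ContinuousWithinAt (fun q => upperThreshold Ω p q r) (Set.Iio p) p := by
    unfold upperThreshold
    -- The exponent equals `1` at `q = p`, so continuity holds without knowing that the eigenvalue
    -- is positive.
    have h2 : ContinuousAt (fun q : ℝ => firstEigenvalue Ω p ^ ((r - q) / (r - p))) p :=
      ContinuousAt.comp' (g := fun y => firstEigenvalue Ω p ^ y)
        (Real.continuousAt_const_rpow' (by simp [h1.ne'])) (by fun_prop)
    have h3 : ContinuousAt (fun q : ℝ => (r - q) ^ (r - q)) p :=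
      ContinuousAt.rpow (by fun_prop) (by fun_prop) (Or.inl h1.ne')
    refine (h2.mul continuousAt_const).continuousWithinAt.mul
      (ContinuousWithinAt.rpow_const (hpow.div h3.continuousWithinAt ?_) (Or.inr ?_))
    · positivity
    · positivity
  have he : upperThreshold Ω p p r = firstEigenvalue Ω p := by
    unfold upperThreshold
    rw [div_self h1.ne', Real.rpow_one, sub_self, Real.rpow_zero,
      Real.div_rpow zero_le_one (by positivity), Real.one_rpow, ← Real.rpow_mul h1.le,
      mul_one_div_cancel h1.ne', Real.rpow_one]
    field_simp
  have := hc.tendsto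
  rw [he] at this
  exact this

end Threshold

end ConcaveConvex

end

theorem proposition3p1 (n : ℕ) (hn : 0 < n) (Ω : Set (EuclideanSpace ℝ (Fin n)))
    (hΩ_open : IsOpen Ω) (hΩ_conn : IsConnected Ω) (hΩ_bdd : Bornology.IsBounded Ω)
    (p r : ℝ) (hp : 1 < p) (hpr : p < r)
    (hr : p < (n : ℝ) → r < (n : ℝ) * p / ((n : ℝ) - p)) :
    (∀ q : ℝ, 1 < q → q < p →
      (∀ Λ : ℝ, ConcaveConvex.upperThreshold Ω p q r < Λ →
        ¬ ∃ u, ConcaveConvex.IsPositiveWeakSolution Ω p q r Λ u) ∧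
      ConcaveConvex.existenceThreshold Ω p q r ≤
        ENNReal.ofReal (ConcaveConvex.upperThreshold Ω p q r)) ∧
    limsup (fun q : ℝ => ConcaveConvex.existenceThreshold Ω p q r) (𝓝[<] p) ≤
      ENNReal.ofReal (ConcaveConvex.firstEigenvalue Ω p) := by
  refine ⟨fun q _ hqp => ⟨fun Λ hΛ => ?_, ?_⟩, ?_⟩
  · exact ConcaveConvex.not_exists_isPositiveWeakSolution hΩ_open hΩ_conn.nonempty hΩ_bdd hp hqp
      hpr hΛ
  · exact ConcaveConvex.existenceThreshold_le hΩ_open hΩ_conn.nonempty hΩ_bdd hp hqp hpr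
  -- The right-hand side is the limit, hence the limsup, of the explicit bounds, so monotonicity of
  -- limsup suffices.
  · rw [← ((ENNReal.continuous_ofReal.tendsto _).comp
      (ConcaveConvex.tendsto_upperThreshold Ω hpr)).limsup_eq]
    refine limsup_le_limsup ?_
    filter_upwards [self_mem_nhdsWithin] with q hq
    exact ConcaveConvex.existenceThreshold_le hΩ_open hΩ_conn.nonempty hΩ_bdd hp hq hpr
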